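/- Let $M$ be a smooth manifold (finite-dimensional, Hausdorff, $\sigma$-compact), $A \to M$ a smooth real vector bundle of finite rank, and $\mu$ a Lie algebroid structure on $A$, with anchor $\rho$, bracket $[\cdot,\cdot]$ on $\Gamma(A)$ and differential $d$. Indices $1,2,3$ are elements of $\mathbb{Z}/3\mathbb{Z}$. For a $2$-form $\omega \in \Gamma(\wedge^2 A^*)$ and a bivector $\pi \in \Gamma(\wedge^2 A)$ let $\omega^\flat : A \to A^*$ and $\pi^\sharp : A^* \to A$ be the bundle maps with $\langle \omega^\flat X, Y\rangle = \omega(X,Y)$ and $\langle \beta, \pi^\sharp\alpha\rangle = \pi(\alpha,\beta)$; $\pi$ is the inverse of $\omega$ if $\pi^\sharp = (\omega^\flat)^{-1}$. Let $\varepsilon = (\varepsilon_1,\varepsilon_2,\varepsilon_3)$ with $\varepsilon_i = \pm 1$. A triplet $(\omega_1,\omega_2,\omega_3)$ of non-degenerate $2$-forms with inverses $\pi_1,\pi_2,\pi_3$ is an $\varepsilon$-hypersymplectic structure with torsion on the Lie algebroid $(A,\mu)$ if the transition morphisms $N_i := \pi_{i-1}^\sharp\circ\omega_{i+1}^\flat$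 satisfy $N_i^2 = \varepsilon_i\,\mathrm{id}_A$ for $i=1,2,3$, and $$\varepsilon_2\, N_1 d\omega_1 = \varepsilon_3\, N_2 d\omega_2 = \varepsilon_1\, N_3 d\omega_3, \qquad N_i d\omega_i(X,Y,Z) := d\omega_i(N_iX,N_iY,N_iZ).$$ It is called a hypersymplectic structure with torsion if $\varepsilon_1=\varepsilon_2=\varepsilon_3=-1$, and a para-hypersymplectic structure with torsion if $\varepsilon_1\varepsilon_2\varepsilon_3=-1$ but the $\varepsilon_i$ are not all $-1$. The same definitions apply to Lie algebroid structures on the bundle $A^*$, with $(A^*)^*$ identified with $A$: a bivector $\pi_i$ on $A$ is then a $2$-form on $A^*$, and its inverse is $\omega_i$. Let $\{\cdot,\cdot\}$ be the big bracket, i.e. the canonical graded Poisson bracket on the functions on $T^*[2]A[1]$. View $\mu$ as the function of degree $3$ with $[X,Y] = \{\{X,\mu\},Y\}$ and $\rho(X)f = \{\{X,\mu\},f\}$, and $\omega$, $\pi$ as the functions of degree $2$ with $\{X,\omega\}=\omega^\flat X$ and $\{\alpha,\pi\} = \pi^\sharp\alpha$. For a bivector $\pi$ with inverse $\omega$ put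 $$\gamma^{\pi} := \mu_\pi + \tfrac12\{\omega,[\pi,\pi]\}, \qquad \mu_\pi := \{\pi,\mu\}, \qquad [\pi,\pi] = \{\{\pi,\mu\},\pi\},$$ where $[\pi,\pi]$ is the Schouten–Nijenhuis bracket of $(A,\mu)$. **Theorem.** Let $(\omega_1,\omega_2,\omega_3)$ be a triplet of non-degenerate $2$-forms on $(A,\mu)$ with inverse bivectors $(\pi_1,\pi_2,\pi_3)$, and let $\varepsilon_1,\varepsilon_2,\varepsilon_3=\pm1$. For each $i\in\{1,2,3\}$, $\varepsilon_i\gamma^{\pi_i}$ is a Lie algebroid structure on $A^*$, with bracket $[\alpha,\beta]=\{\{\alpha,\varepsilon_i\gamma^{\pi_i}\},\beta\}$ and with anchor given by $f\mapsto\{\{\alpha,\varepsilon_i\gamma^{\pi_i}\},f\}$, and $(\omega_1,\omega_2,\omega_3)$ is a hypersymplectic (respectively, para-hypersymplectic) structure with torsion on $(A,\mu)$ for the signs $\varepsilon$ if and only if $(\pi_1,\pi_2,\pi_3)$ is a hypersymplectic (respectively, para-hypersymplectic) structure with torsion on $(A^*,\varepsilon_i\gamma^{\pi_i})$ for the same signs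 $\varepsilon$. -/

import Mathlib

open Bundle (TotalSpace)
open scoped Manifold

local notation "∞" => ((⊤ : ℕ∞) : WithTop ℕ∞)

noncomputable section

namespace HSTorsion

variable (E : Type*) [NormedAddCommGroup E] [NormedSpace ℝ E]
  {M : Type*} [TopologicalSpace M] [ChartedSpace E M]
  (F : Type*) [NormedAddCommGroup F] [NormedSpace ℝ F]
  (V : M → Type*) [TopologicalSpace (TotalSpace F V)]
  [∀ x, AddCommGroup (V x)] [∀ x, Module ℝ (V x)] [∀ x, TopologicalSpace (V x)]
  [FiberBundle F V] [VectorBundle ℝ F V]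
  (F' : Type*) [NormedAddCommGroup F'] [NormedSpace ℝ F']
  (W : M → Type*) [TopologicalSpace (TotalSpace F' W)]
  [∀ x, AddCommGroup (W x)] [∀ x, Module ℝ (W x)] [∀ x, TopologicalSpace (W x)]
  [FiberBundle F' W] [VectorBundle ℝ F' W]

/-- `Γ(V)`: the smooth global sections of a vector bundle `V → M`. -/
abbrev Sec : Type _ := ContMDiffSection 𝓘(ℝ, E) F ∞ V

/-- A morphism of smooth vector bundles `V → W` over the identity of `M`: a family of linear maps
`V x → W x` whose total map `V → W` is smooth. -/
structure BundleMap where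
  /-- the linear map on the fibre over `x` -/
  toFun : ∀ x, V x →ₗ[ℝ] W x
  smooth : ContMDiff (𝓘(ℝ, E).prod 𝓘(ℝ, F)) (𝓘(ℝ, E).prod 𝓘(ℝ, F')) ∞
    (fun v : TotalSpace F V => (TotalSpace.mk' F' v.1 (toFun v.1 v.2) : TotalSpace F' W))

/-- The dual bundle `V* → M`. -/
abbrev DualBundle (V : M → Type*) [∀ x, AddCommGroup (V x)] [∀ x, Module ℝ (V x)]
    [∀ x, TopologicalSpace (V x)] : M → Type _ :=
  fun x => V x →L[ℝ] Bundle.Trivial M ℝ x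

/-- A smooth fibrewise nondegenerate pairing `⟨·,·⟩ : W × V → ℝ` of two vector bundles over `M`.
It identifies `W` with `V*` and, at the same time, `V` with `W*`. It is used for the evaluation
pairing of `V*` with `V`, and for the same pairing read the other way, which is the canonical
identification of `V` with the dual bundle of `V*`. -/
structure Pairing where
  /-- the pairing `⟨a, v⟩` on the fibres over `x` -/
  pair : ∀ x, W x →ₗ[ℝ] V x →ₗ[ℝ] ℝ
  nondegenerate : ∀ x, (pair x).Nondegenerate
  smooth : ∀ (α : Sec E F' W) (X : Sec E F V),
    ContMDiff 𝓘(ℝ, E) 𝓘(ℝ, ℝ) ∞ (fun x => pair x (α x) (X x))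

variable {E F V F' W}

/-- The section `φ X` of `W`, for a bundle morphism `φ : V → W` and a section `X` of `V`. -/
def BundleMap.map (φ : BundleMap E F V F' W) (X : Sec E F V) : Sec E F' W where
  toFun x := φ.toFun x (X x)
  contMDiff_toFun := φ.smooth.comp X.contMDiff

/-- The same pairing with the two bundles interchanged: `⟨v, a⟩ = ⟨a, v⟩`. -/
def Pairing.flip (p : Pairing E F V F' W) : Pairing E F' W F V where
  pair x := (p.pair x).flip
  nondegenerate x := ⟨(p.nondegenerate x).2, (p.nondegenerate x).1⟩
  smooth X α := p.smooth α X

/-- The function `⟨α, X⟩` on `M`. -/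
def Pairing.apply (p : Pairing E F V F' W) (α : Sec E F' W) (X : Sec E F V) : M → ℝ :=
  fun x => p.pair x (α x) (X x)

/-- The evaluation pairing of the dual bundle `V*` with `V`. -/
def dualPairing (E : Type*) [NormedAddCommGroup E] [NormedSpace ℝ E]
    {M : Type*} [TopologicalSpace M] [ChartedSpace E M]
    (F : Type*) [NormedAddCommGroup F] [NormedSpace ℝ F]
    (V : M → Type*) [TopologicalSpace (TotalSpace F V)]
    [∀ x, AddCommGroup (V x)] [∀ x, Module ℝ (V x)] [∀ x, TopologicalSpace (V x)]
    [FiberBundle F V] [VectorBundle ℝ F V] :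
    Pairing E F V (F →L[ℝ] ℝ) (DualBundle V) where
  pair x :=
    { toFun := fun a => (a : V x →L[ℝ] ℝ).toLinearMap
      map_add' := fun _ _ => rfl
      map_smul' := fun _ _ => rfl }
  nondegenerate x := by
    refine ⟨fun a h => ContinuousLinearMap.ext fun v => h v, fun v h => ?_⟩
    let e : V x ≃L[ℝ] F := (FiberBundle.trivializationAt F V x).continuousLinearEquivAt ℝ x
      (FiberBundle.mem_baseSet_trivializationAt' x)
    apply e.injective
    rw [map_zero]
    by_contra hv
    obtain ⟨g, hg⟩ := SeparatingDual.exists_ne_zero (R := ℝ) hv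
    exact hg (h (g.comp e.toContinuousLinearMap))
  smooth α X := by
    have h := ContMDiff.clm_bundle_apply (E₁ := V) (E₂ := Bundle.Trivial M ℝ)
      α.contMDiff X.contMDiff
    intro x
    exact (Bundle.contMDiffAt_section (E := Bundle.Trivial M ℝ) x).1 (h x)

/-- A `2`-form `ω ∈ Γ(Λ² V*)`, where `V*` is identified with `W` by the pairing `p`: a bundle
morphism `ω♭ : V → W`, with `ω(X, Y) = ⟨ω♭ X, Y⟩` alternating. -/
structure TwoForm (p : Pairing E F V F' W) where
  /-- the bundle morphism `ω♭` -/
  flat : BundleMap E F V F' W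
  alternating : ∀ x (v : V x), p.pair x (flat.toFun x v) v = 0

/-- A bivector `π ∈ Γ(Λ² V)` is an alternating `2`-form on the bundle `W = V*`: it is the bundle
morphism `π♯ : W → V`, with `π(α, β) = ⟨β, π♯ α⟩` alternating. -/
abbrev Bivector (p : Pairing E F V F' W) : Type _ := TwoForm p.flip

/-- `π♯` -/
abbrev Bivector.sharp {p : Pairing E F V F' W} (π : Bivector p) : BundleMap E F' W F V :=
  TwoForm.flat π

/-- `ω(X, Y) = ⟨ω♭ X, Y⟩` -/
def TwoForm.eval {p : Pairing E F V F' W} (ω : TwoForm p) (X Y : Sec E F V) : M → ℝ :=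
  p.apply (ω.flat.map X) Y

/-- The bivector `π` is the inverse of the `2`-form `ω`: the maps `ω♭` and `π♯` are inverse to
each other. -/
def IsInverse {p : Pairing E F V F' W} (ω : TwoForm p) (π : Bivector p) : Prop :=
  ∀ x, (∀ v : V x, π.sharp.toFun x (ω.flat.toFun x v) = v) ∧
    (∀ a : W x, ω.flat.toFun x (π.sharp.toFun x a) = a)

/-- The section `f X`, for a smooth function `f` and a section `X`. -/
def fsmul (f : C^∞⟮𝓘(ℝ, E), M; ℝ⟯) (X : Sec E F V) : Sec E F V where
  toFun x := f x • X x
  contMDiff_toFun := ContMDiff.smul_section f.contMDiff X.contMDiff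

/-- The derivative of the function `f` along the field of tangent vectors `u`. -/
def dirDeriv (E : Type*) [NormedAddCommGroup E] [NormedSpace ℝ E]
    {M : Type*} [TopologicalSpace M] [ChartedSpace E M]
    (u : ∀ x : M, TangentSpace 𝓘(ℝ, E) x) (f : M → ℝ) : M → ℝ :=
  fun x => mvfderiv 𝓘(ℝ, E) f x (u x)

section LieAlgebroid

variable [IsManifold 𝓘(ℝ, E) ∞ M]

variable (E F V) in
/-- A Lie algebroid structure on the vector bundle `V → M`: an anchor `ρ : V → TM` and a Lie
bracket on `Γ(V)` with `[X, f Y] = f [X, Y] + (ρ(X) f) Y`. -/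
structure LieAlgebroid where
  /-- the anchor `ρ` -/
  anchor : BundleMap E F V E (fun x : M => TangentSpace 𝓘(ℝ, E) x)
  /-- the bracket of sections -/
  bracket : Sec E F V → Sec E F V → Sec E F V
  add_left : ∀ X Y Z, bracket (X + Y) Z = bracket X Z + bracket Y Z
  smul_left : ∀ (c : ℝ) X Y, bracket (c • X) Y = c • bracket X Y
  skew : ∀ X Y, bracket X Y = -bracket Y X
  jacobi : ∀ X Y Z,
    bracket X (bracket Y Z) = bracket (bracket X Y) Z + bracket Y (bracket X Z)
  leibniz : ∀ (X Y : Sec E F V) (f : C^∞⟮𝓘(ℝ, E), M; ℝ⟯) (x : M),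
    bracket X (fsmul f Y) x =
      f x • bracket X Y x + dirDeriv E (fun y => anchor.toFun y (X y)) f x • Y x

/-- `ρ(X) f` -/
def LieAlgebroid.deriv (L : LieAlgebroid E F V) (X : Sec E F V) (f : M → ℝ) : M → ℝ :=
  dirDeriv E (fun x => L.anchor.toFun x (X x)) f

/-- `dω(X, Y, Z)`, for the differential `d` of the Lie algebroid. -/
def LieAlgebroid.d (L : LieAlgebroid E F V) {p : Pairing E F V F' W} (ω : TwoForm p)
    (X Y Z : Sec E F V) : M → ℝ :=
  L.deriv X (ω.eval Y Z) - L.deriv Y (ω.eval X Z) + L.deriv Z (ω.eval X Y)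
    - ω.eval (L.bracket X Y) Z + ω.eval (L.bracket X Z) Y - ω.eval (L.bracket Y Z) X

/-- The transition morphism `N i = π (i-1)♯ ∘ ω (i+1)♭`, for indices in `ℤ/3`. -/
def transition {p : Pairing E F V F' W} (ω : ZMod 3 → TwoForm p) (π : ZMod 3 → Bivector p)
    (i : ZMod 3) (X : Sec E F V) : Sec E F V :=
  (π (i - 1)).sharp.map ((ω (i + 1)).flat.map X)

/-- `(ω 1, ω 2, ω 3)` is an `ε`-hypersymplectic structure with torsion on the Lie algebroid `L`:
the `2`-forms `ω i` are non-degenerate, with inverses `π i`, the transition morphisms satisfy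
`N i ∘ N i = ε i • id`, and `ε 2 • N 1 dω 1 = ε 3 • N 2 dω 2 = ε 1 • N 3 dω 3`, where
`N i dω i (X, Y, Z) = dω i (N i X, N i Y, N i Z)`. -/
def IsEpsHST (L : LieAlgebroid E F V) {p : Pairing E F V F' W} (ε : ZMod 3 → ℝ)
    (ω : ZMod 3 → TwoForm p) : Prop :=
  ∃ π : ZMod 3 → Bivector p,
    (∀ i, IsInverse (ω i) (π i)) ∧
    (∀ i X, transition ω π i (transition ω π i X) = ε i • X) ∧
    (∀ i j X Y Z,
      ε (i + 1) •
          L.d (ω i) (transition ω π i X) (transition ω π i Y) (transition ω π i Z) =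
        ε (j + 1) •
          L.d (ω j) (transition ω π j X) (transition ω π j Y) (transition ω π j Z))

/-- Hypersymplectic structures with torsion: `ε 1 = ε 2 = ε 3 = -1`. -/
def IsHypersymplecticWithTorsion (L : LieAlgebroid E F V) {p : Pairing E F V F' W}
    (ε : ZMod 3 → ℝ) (ω : ZMod 3 → TwoForm p) : Prop :=
  (∀ i, ε i = -1) ∧ IsEpsHST L ε ω

/-- Para-hypersymplectic structures with torsion: `ε 1 * ε 2 * ε 3 = -1`, but the signs are not
all equal to `-1`. -/
def IsParaHypersymplecticWithTorsion (L : LieAlgebroid E F V) {p : Pairing E F V F' W}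
    (ε : ZMod 3 → ℝ) (ω : ZMod 3 → TwoForm p) : Prop :=
  ε 1 * ε 2 * ε 3 = -1 ∧ (¬ ∀ i, ε i = -1) ∧ IsEpsHST L ε ω

/-- Sections of `V ⊕ W = V ⊕ V*`. -/
abbrev DSec (_p : Pairing E F V F' W) : Type _ := Sec E F V × Sec E F' W

/-- A function `Θ` of degree `3` on the graded symplectic manifold `T*[2]V[1]`, given by its
derived brackets: for sections `e`, `e₁`, `e₂`, `e₃` of `V ⊕ V*` and a function `f` on `M`,
`{{e, Θ}, f}` is the derivative of `f` along `anchor e`, and `form e₁ e₂ e₃` is the pairing of the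
section `{{e₁, Θ}, e₂}` with `e₃`. -/
@[ext]
structure Cubic (p : Pairing E F V F' W) where
  /-- the field of tangent vectors by which `{{e, Θ}, ·}` acts on functions -/
  anchor : DSec p → ∀ x : M, TangentSpace 𝓘(ℝ, E) x
  /-- `⟨{{e₁, Θ}, e₂}, e₃⟩` -/
  form : DSec p → DSec p → DSec p → M → ℝ

namespace Cubic

variable {p : Pairing E F V F' W}

/-- The sum of two functions of degree `3`. -/
def add (Θ Θ' : Cubic p) : Cubic p where
  anchor e := Θ.anchor e + Θ'.anchor e
  form e₁ e₂ e₃ := Θ.form e₁ e₂ e₃ + Θ'.form e₁ e₂ e₃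

/-- The multiple of a function of degree `3` by a real number. -/
def smul (c : ℝ) (Θ : Cubic p) : Cubic p where
  anchor e := c • Θ.anchor e
  form e₁ e₂ e₃ := c • Θ.form e₁ e₂ e₃

instance : Add (Cubic p) := ⟨add⟩

instance : SMul ℝ (Cubic p) := ⟨smul⟩

/-- The big bracket `{I, Θ}` of a function of degree `2`, given as a skew-symmetric endomorphism
`I` of `V ⊕ V*` (by `I e = {e, I}`), with a function `Θ` of degree `3`. By the Jacobi identity
`{{e₁, {I, Θ}}, e₂} = {{I e₁, Θ}, e₂} + {{e₁, Θ}, I e₂} - I {{e₁, Θ}, e₂}` and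
`{{e, {I, Θ}}, f} = {{I e, Θ}, f}`; as `I` is skew-symmetric, the pairing of
`- I {{e₁, Θ}, e₂}` with `e₃` is that of `{{e₁, Θ}, e₂}` with `I e₃`. -/
def bigBracket (I : DSec p → DSec p) (Θ : Cubic p) : Cubic p where
  anchor e := Θ.anchor (I e)
  form e₁ e₂ e₃ := Θ.form (I e₁) e₂ e₃ + Θ.form e₁ (I e₂) e₃ + Θ.form e₁ e₂ (I e₃)

end Cubic

/-- The bivector `π` as a function of degree `2`: the endomorphism `X + α ↦ π♯ α`. -/
def Bivector.endo {p : Pairing E F V F' W} (π : Bivector p) : DSec p → DSec p :=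
  fun e => (π.sharp.map e.2, 0)

/-- The `2`-form `ω` as a function of degree `2`: the endomorphism `X + α ↦ ω♭ X`. -/
def TwoForm.endo {p : Pairing E F V F' W} (ω : TwoForm p) : DSec p → DSec p :=
  fun e => (0, ω.flat.map e.1)

/-- `⟨L_X β, Z⟩ = ρ(X)⟨β, Z⟩ - ⟨β, [X, Z]⟩`, the Lie derivative of the `1`-form `β`. -/
def LieAlgebroid.lieDerivative (L : LieAlgebroid E F V) (p : Pairing E F V F' W)
    (X : Sec E F V) (β : Sec E F' W) (Z : Sec E F V) : M → ℝ :=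
  L.deriv X (p.apply β Z) - p.apply β (L.bracket X Z)

/-- `dα(Y, Z) = ρ(Y)⟨α, Z⟩ - ρ(Z)⟨α, Y⟩ - ⟨α, [Y, Z]⟩`, the differential of the `1`-form `α`. -/
def LieAlgebroid.dOne (L : LieAlgebroid E F V) (p : Pairing E F V F' W)
    (α : Sec E F' W) (Y Z : Sec E F V) : M → ℝ :=
  L.deriv Y (p.apply α Z) - L.deriv Z (p.apply α Y) - p.apply α (L.bracket Y Z)

/-- The function `μ` of degree `3` of a Lie algebroid. Its derived bracket is the Dorfman bracket
`[X + α, Y + β] = [X, Y] + L_X β - i_Y dα` of `V ⊕ V*`, and `{{X + α, μ}, f} = ρ(X) f`. -/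
def LieAlgebroid.toCubic (L : LieAlgebroid E F V) (p : Pairing E F V F' W) : Cubic p where
  anchor e := fun x => L.anchor.toFun x (e.1 x)
  form e₁ e₂ e₃ :=
    p.apply e₃.2 (L.bracket e₁.1 e₂.1)
      + (L.lieDerivative p e₁.1 e₂.2 e₃.1 - L.dOne p e₁.2 e₂.1 e₃.1)

/-- The Schouten-Nijenhuis bracket `[π, π] = {{π, μ}, π} = -{π, {π, μ}}` of a bivector on the Lie
algebroid. -/
def schouten (L : LieAlgebroid E F V) {p : Pairing E F V F' W} (π : Bivector p) : Cubic p :=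
  (-1 : ℝ) • Cubic.bigBracket π.endo (Cubic.bigBracket π.endo (L.toCubic p))

/-- `γ^π = μ_π + ½ {ω, [π, π]}`, where `μ_π = {π, μ}`. -/
def gamma (L : LieAlgebroid E F V) {p : Pairing E F V F' W} (ω : TwoForm p) (π : Bivector p) :
    Cubic p :=
  Cubic.bigBracket π.endo (L.toCubic p) +
    (1 / 2 : ℝ) • Cubic.bigBracket ω.endo (schouten L π)

/-- The Lie algebroid structure `K` on `W = V*` is the one given by the function `Θ` of degree
`3`: the derivative of functions along the anchor of `K` is `{{α, Θ}, ·}`, and its bracket is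
`[α, β] = {{α, Θ}, β}`. -/
def IsStructureOf {p : Pairing E F V F' W} (K : LieAlgebroid E F' W) (Θ : Cubic p) : Prop :=
  (∀ (α : Sec E F' W) (x : M), K.anchor.toFun x (α x) = Θ.anchor (0, α) x) ∧
    ∀ (α β : Sec E F' W) (Y : Sec E F V),
      p.apply (K.bracket α β) Y = Θ.form (0, α) (0, β) (Y, 0)

end LieAlgebroid

end HSTorsion

end

set_option linter.unusedSectionVars false

/-! The function `γ^π` is `μ` transported along `ω♭`: its derived bracket is `ω♭ [π♯ α, π♯ β]` and
its anchor is `ρ ∘ π♯` (`gamma_form`, `gamma_anchor`). A constant multiple of a transported Lie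
algebroid structure is again one, which gives existence.

For the equivalence, fix `j` and move everything from `V` to `W` by `ω j♭`. The relations `N i ^ 2 =
ε i` yield `ω j♭ π i♯ ω j♭ = s • ω i♭` with `s = ±1`, so `ω j♭` carries `dω i` to `dπ i` up to sign
(`IsStructureOf.d_flat`), and it carries the transition morphisms of the forms to those of the
bivectors up to sign (`transition_flat`). Since `ε 1 * ε 2 * ε 3 = -1`, these signs cancel, and each
torsion `N i dω i` corresponds exactly to its counterpart on `W`
(`IsStructureOf.d_transition_flat`). Both kinds of structure satisfy this product condition. -/

namespace HSTorsion

section Bundles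

variable {E : Type*} [NormedAddCommGroup E] [NormedSpace ℝ E]
  {M : Type*} [TopologicalSpace M] [ChartedSpace E M]
  {F : Type*} [NormedAddCommGroup F] [NormedSpace ℝ F]
  {V : M → Type*} [TopologicalSpace (TotalSpace F V)]
  [∀ x, AddCommGroup (V x)] [∀ x, Module ℝ (V x)] [∀ x, TopologicalSpace (V x)]
  [FiberBundle F V] [VectorBundle ℝ F V]
  {F' : Type*} [NormedAddCommGroup F'] [NormedSpace ℝ F']
  {W : M → Type*} [TopologicalSpace (TotalSpace F' W)]
  [∀ x, AddCommGroup (W x)] [∀ x, Module ℝ (W x)] [∀ x, TopologicalSpace (W x)]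
  [FiberBundle F' W] [VectorBundle ℝ F' W]
  {F'' : Type*} [NormedAddCommGroup F''] [NormedSpace ℝ F'']
  {U : M → Type*} [TopologicalSpace (TotalSpace F'' U)]
  [∀ x, AddCommGroup (U x)] [∀ x, Module ℝ (U x)] [∀ x, TopologicalSpace (U x)]
  [FiberBundle F'' U] [VectorBundle ℝ F'' U]

/-! ### Algebra of bundle morphisms, pairings and 2-forms. -/

namespace BundleMap

/-- The composition of two bundle morphisms. -/
def comp (ψ : BundleMap E F' W F'' U) (φ : BundleMap E F V F' W) : BundleMap E F V F'' U where
  toFun x := ψ.toFun x ∘ₗ φ.toFun x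
  smooth := ψ.smooth.comp φ.smooth

/-- Multiplication by a real number, as a bundle morphism. -/
def homothety (V : M → Type*) [TopologicalSpace (TotalSpace F V)]
    [∀ x, AddCommGroup (V x)] [∀ x, Module ℝ (V x)] [∀ x, TopologicalSpace (V x)]
    [FiberBundle F V] [VectorBundle ℝ F V] [ContMDiffVectorBundle ∞ F V 𝓘(ℝ, E)] (c : ℝ) :
    BundleMap E F V F V where
  toFun x := c • LinearMap.id
  smooth := by
    intro v₀
    have hid : ContMDiffAt (𝓘(ℝ, E).prod 𝓘(ℝ, F)) (𝓘(ℝ, E).prod 𝓘(ℝ, F)) ∞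
      (fun v : TotalSpace F V => v) v₀ := contMDiffAt_id
    rw [Bundle.contMDiffAt_totalSpace] at hid ⊢
    refine ⟨hid.1, ?_⟩
    have h2 : ContMDiffAt (𝓘(ℝ, E).prod 𝓘(ℝ, F)) 𝓘(ℝ, F) ∞
        (fun v : TotalSpace F V => c • (FiberBundle.trivializationAt F V v₀.proj v).2) v₀ :=
      (contMDiffAt_const (I := 𝓘(ℝ, E).prod 𝓘(ℝ, F)) (I' := 𝓘(ℝ, ℝ)) (c := c)).smul hid.2
    refine h2.congr_of_eventuallyEq ?_
    have hmem : ∀ᶠ v : TotalSpace F V in nhds v₀,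
        v.proj ∈ (FiberBundle.trivializationAt F V v₀.proj).baseSet :=
      (FiberBundle.continuous_proj F V).continuousAt.eventually
        ((FiberBundle.trivializationAt F V v₀.proj).open_baseSet.mem_nhds
          (FiberBundle.mem_baseSet_trivializationAt' v₀.proj))
    filter_upwards [hmem] with v hv
    exact ((FiberBundle.trivializationAt F V v₀.proj).linear ℝ hv).map_smul c v.2

@[simp]
lemma map_apply (φ : BundleMap E F V F' W) (X : Sec E F V) (x : M) :
    φ.map X x = φ.toFun x (X x) := rfl

@[simp]
lemma map_add (φ : BundleMap E F V F' W) (X Y : Sec E F V) :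
    φ.map (X + Y) = φ.map X + φ.map Y :=
  ContMDiffSection.ext fun x => (φ.toFun x).map_add (X x) (Y x)

@[simp]
lemma map_smul (φ : BundleMap E F V F' W) (c : ℝ) (X : Sec E F V) :
    φ.map (c • X) = c • φ.map X :=
  ContMDiffSection.ext fun x => (φ.toFun x).map_smul c (X x)

@[simp]
lemma map_neg (φ : BundleMap E F V F' W) (X : Sec E F V) : φ.map (-X) = -φ.map X :=
  ContMDiffSection.ext fun x => (φ.toFun x).map_neg (X x)

@[simp]
lemma map_zero (φ : BundleMap E F V F' W) : φ.map 0 = 0 :=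
  ContMDiffSection.ext fun x => (φ.toFun x).map_zero

lemma map_fsmul (φ : BundleMap E F V F' W) (f : C^∞⟮𝓘(ℝ, E), M; ℝ⟯) (X : Sec E F V) :
    φ.map (fsmul f X) = fsmul f (φ.map X) :=
  ContMDiffSection.ext fun x => (φ.toFun x).map_smul (f x) (X x)

end BundleMap

namespace Pairing

variable (p : Pairing E F V F' W)

@[simp]
lemma apply_zero_left (X : Sec E F V) : p.apply 0 X = 0 :=
  funext fun x => by simp [apply]

@[simp]
lemma apply_zero_right (α : Sec E F' W) : p.apply α 0 = 0 :=
  funext fun x => by simp [apply]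

@[simp]
lemma apply_smul_left (c : ℝ) (α : Sec E F' W) (X : Sec E F V) :
    p.apply (c • α) X = c • p.apply α X :=
  funext fun x => by simp [apply]

@[simp]
lemma apply_smul_right (c : ℝ) (α : Sec E F' W) (X : Sec E F V) :
    p.apply α (c • X) = c • p.apply α X :=
  funext fun x => by simp [apply]

lemma flip_apply (α : Sec E F' W) (X : Sec E F V) : p.flip.apply X α = p.apply α X := rfl

end Pairing

namespace TwoForm

variable {p : Pairing E F V F' W}

lemma pair_flat_comm (ω : TwoForm p) (x : M) (v w : V x) :
    p.pair x (ω.flat.toFun x v) w = -p.pair x (ω.flat.toFun x w) v := by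
  have h := ω.alternating x (v + w)
  simp only [map_add, LinearMap.add_apply, ω.alternating, zero_add, add_zero] at h
  linarith

lemma apply_flat_comm (ω : TwoForm p) (X Y : Sec E F V) :
    p.apply (ω.flat.map X) Y = -p.apply (ω.flat.map Y) X :=
  funext fun x => ω.pair_flat_comm x (X x) (Y x)

lemma eval_smul_left (ω : TwoForm p) (c : ℝ) (X Y : Sec E F V) :
    ω.eval (c • X) Y = c • ω.eval X Y := by
  simp [eval]

lemma eval_smul_right (ω : TwoForm p) (c : ℝ) (X Y : Sec E F V) :
    ω.eval X (c • Y) = c • ω.eval X Y := by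
  simp [eval]

lemma contMDiff_eval (ω : TwoForm p) (X Y : Sec E F V) :
    ContMDiff 𝓘(ℝ, E) 𝓘(ℝ, ℝ) ∞ (ω.eval X Y) :=
  p.smooth (ω.flat.map X) Y

end TwoForm

namespace IsInverse

variable {p : Pairing E F V F' W} {ω : TwoForm p} {π : Bivector p}

lemma sharp_flat (h : IsInverse ω π) (X : Sec E F V) : π.sharp.map (ω.flat.map X) = X :=
  ContMDiffSection.ext fun x => (h x).1 (X x)

lemma flat_sharp (h : IsInverse ω π) (α : Sec E F' W) : ω.flat.map (π.sharp.map α) = α :=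
  ContMDiffSection.ext fun x => (h x).2 (α x)

lemma symm (h : IsInverse ω π) : IsInverse (p := p.flip) π ω :=
  fun x => ⟨(h x).2, (h x).1⟩

lemma sharp_map_eq (h : IsInverse ω π) {π' : Bivector p} (h' : IsInverse ω π')
    (α : Sec E F' W) : π'.sharp.map α = π.sharp.map α := by
  rw [← h'.sharp_flat (π.sharp.map α), h.flat_sharp]

end IsInverse

/-! ### Scaling of derivatives, brackets and differentials; transport of a Lie algebroid. -/

lemma dirDeriv_zero_left (f : M → ℝ) :
    dirDeriv E (fun x => (0 : TangentSpace 𝓘(ℝ, E) x)) f = 0 :=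
  funext fun x => (mvfderiv 𝓘(ℝ, E) f x).map_zero

lemma dirDeriv_smul_left (c : ℝ) (u : ∀ x : M, TangentSpace 𝓘(ℝ, E) x) (f : M → ℝ) :
    dirDeriv E (fun x => c • u x) f = c • dirDeriv E u f :=
  funext fun x => (mvfderiv 𝓘(ℝ, E) f x).map_smul c (u x)

lemma dirDeriv_zero_right (u : ∀ x : M, TangentSpace 𝓘(ℝ, E) x) :
    dirDeriv E u (0 : M → ℝ) = 0 := by
  funext x
  simp [dirDeriv, mvfderiv_zero]

lemma dirDeriv_smul_right (u : ∀ x : M, TangentSpace 𝓘(ℝ, E) x) (c : ℝ) {f : M → ℝ}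
    (hf : ContMDiff 𝓘(ℝ, E) 𝓘(ℝ, ℝ) ∞ f) : dirDeriv E u (c • f) = c • dirDeriv E u f := by
  funext x
  have h := mvfderiv_smul (I := 𝓘(ℝ, E)) (x := x) (a := fun _ : M => c) (g := f)
    mdifferentiableAt_const (hf.mdifferentiable (by simp) x)
  have h' : mvfderiv 𝓘(ℝ, E) (c • f) x = c • mvfderiv 𝓘(ℝ, E) f x := by
    change mvfderiv 𝓘(ℝ, E) ((fun _ : M => c) • f) x = _
    rw [h, mvfderiv_const]
    ext v
    simp
  simp [dirDeriv, h']

namespace LieAlgebroid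

variable [IsManifold 𝓘(ℝ, E) ∞ M] (L : LieAlgebroid E F V)

lemma smul_right (c : ℝ) (X Y : Sec E F V) : L.bracket X (c • Y) = c • L.bracket X Y := by
  rw [L.skew, L.smul_left, L.skew Y X, smul_neg, neg_neg]

@[simp]
lemma bracket_zero_left (X : Sec E F V) : L.bracket 0 X = 0 := by
  simpa using L.smul_left 0 0 X

@[simp]
lemma bracket_zero_right (X : Sec E F V) : L.bracket X 0 = 0 := by
  simpa using L.smul_right 0 X 0

@[simp]
lemma deriv_zero_left (f : M → ℝ) : L.deriv 0 f = 0 := by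
  have h : (fun x => L.anchor.toFun x ((0 : Sec E F V) x)) =
      fun x => (0 : TangentSpace 𝓘(ℝ, E) x) := funext fun x => (L.anchor.toFun x).map_zero
  rw [deriv, h, dirDeriv_zero_left]

@[simp]
lemma deriv_zero_right (X : Sec E F V) : L.deriv X 0 = 0 := dirDeriv_zero_right _

lemma deriv_smul_left (c : ℝ) (X : Sec E F V) (f : M → ℝ) :
    L.deriv (c • X) f = c • L.deriv X f := by
  rw [deriv, deriv, ← dirDeriv_smul_left]
  congr 1
  exact funext fun x => (L.anchor.toFun x).map_smul c (X x)

lemma deriv_smul_right (X : Sec E F V) (c : ℝ) {f : M → ℝ}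
    (hf : ContMDiff 𝓘(ℝ, E) 𝓘(ℝ, ℝ) ∞ f) : L.deriv X (c • f) = c • L.deriv X f :=
  dirDeriv_smul_right _ c hf

lemma d_smul {p : Pairing E F V F' W} (ω : TwoForm p) (c : ℝ) (X Y Z : Sec E F V) :
    L.d ω (c • X) (c • Y) (c • Z) = c ^ 3 • L.d ω X Y Z := by
  have hd (X Y Z : Sec E F V) :
      L.deriv (c • X) (ω.eval (c • Y) (c • Z)) = c ^ 3 • L.deriv X (ω.eval Y Z) := by
    rw [deriv_smul_left, ω.eval_smul_left, ω.eval_smul_right, smul_smul,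
      deriv_smul_right _ _ _ (ω.contMDiff_eval Y Z), smul_smul]
    ring_nf
  have hb (X Y Z : Sec E F V) :
      ω.eval (L.bracket (c • X) (c • Y)) (c • Z) = c ^ 3 • ω.eval (L.bracket X Y) Z := by
    rw [L.smul_left, L.smul_right, ω.eval_smul_left, ω.eval_smul_left, ω.eval_smul_right,
      smul_smul, smul_smul]
    ring_nf
  rw [d, d, hd, hd, hd, hb, hb, hb]
  module

section Transport

variable {p : Pairing E F V F' W} {ω : TwoForm p} {π : Bivector p}

/-- The Lie algebroid structure on `W`, multiplied by the number `c`, that corresponds to `L`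
under the isomorphism `ω♭ : V → W` with inverse `π♯`. -/
noncomputable def transport [ContMDiffVectorBundle ∞ F V 𝓘(ℝ, E)] (hinv : IsInverse ω π) (c : ℝ) :
    LieAlgebroid E F' W where
  -- The factor is applied in `V`, between `π♯` and `ρ`, so only the smoothness of scaling on `V` is
  -- needed.
  anchor := L.anchor.comp ((BundleMap.homothety V c).comp π.sharp)
  bracket α β := c • ω.flat.map (L.bracket (π.sharp.map α) (π.sharp.map β))
  add_left α β γ := by simp [L.add_left]
  smul_left a α β := by simp [L.smul_left, smul_comm c a]
  skew α β := by
    rw [L.skew]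
    simp
  jacobi α β γ := by
    -- Each iterated bracket acquires the factor `c` twice, so any real `c` is admissible.
    simp only [BundleMap.map_smul, hinv.sharp_flat, L.smul_left, L.smul_right]
    rw [L.jacobi]
    simp
  leibniz α β f x := by
    rw [BundleMap.map_fsmul]
    have h := L.leibniz (π.sharp.map α) (π.sharp.map β) f x
    have hβ := (hinv x).2 (β x)
    have hu : dirDeriv E (fun y => (L.anchor.comp
        ((BundleMap.homothety V c).comp π.sharp)).toFun y (α y)) f x =
        c * dirDeriv E (fun y => L.anchor.toFun y (π.sharp.map α y)) f x := by
      rw [← smul_eq_mul, ← Pi.smul_apply, ← dirDeriv_smul_left]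
      congr 1
      exact funext fun y => (L.anchor.toFun y).map_smul c _
    rw [hu]
    simp only [ContMDiffSection.coe_smul, Pi.smul_apply, BundleMap.map_apply] at h ⊢
    rw [h]
    simp only [_root_.map_add, _root_.map_smul, hβ]
    module

end Transport

end LieAlgebroid

/-! ### The structure `γ^π` as a transported structure. -/

section Gamma

variable [IsManifold 𝓘(ℝ, E) ∞ M] (L : LieAlgebroid E F V)
  {p : Pairing E F V F' W} {ω : TwoForm p} {π : Bivector p}

/-- A `Cubic` is not assumed multilinear, so vanishing on zero sections is checked for `μ` itself.
-/
lemma LieAlgebroid.toCubic_form_zero_left (e₂ e₃ : DSec p) :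
    (L.toCubic p).form (0, 0) e₂ e₃ = 0 := by
  simp [toCubic, lieDerivative, dOne]

lemma LieAlgebroid.toCubic_form_zero_middle (e₁ e₃ : DSec p) :
    (L.toCubic p).form e₁ (0, 0) e₃ = 0 := by
  simp [toCubic, lieDerivative, dOne]

lemma LieAlgebroid.toCubic_form_zero_right (e₁ e₂ : DSec p) :
    (L.toCubic p).form e₁ e₂ (0, 0) = 0 := by
  simp [toCubic, lieDerivative, dOne]

namespace Cubic

lemma add_form (Θ Θ' : Cubic p) (e₁ e₂ e₃ : DSec p) :
    (Θ + Θ').form e₁ e₂ e₃ = Θ.form e₁ e₂ e₃ + Θ'.form e₁ e₂ e₃ := rfl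

lemma smul_form (c : ℝ) (Θ : Cubic p) (e₁ e₂ e₃ : DSec p) :
    (c • Θ).form e₁ e₂ e₃ = c • Θ.form e₁ e₂ e₃ := rfl

lemma bigBracket_form (I : DSec p → DSec p) (Θ : Cubic p) (e₁ e₂ e₃ : DSec p) :
    (bigBracket I Θ).form e₁ e₂ e₃ =
      Θ.form (I e₁) e₂ e₃ + Θ.form e₁ (I e₂) e₃ + Θ.form e₁ e₂ (I e₃) := rfl

lemma add_anchor (Θ Θ' : Cubic p) (e : DSec p) :
    (Θ + Θ').anchor e = Θ.anchor e + Θ'.anchor e := rfl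

lemma smul_anchor (c : ℝ) (Θ : Cubic p) (e : DSec p) : (c • Θ).anchor e = c • Θ.anchor e := rfl

lemma bigBracket_anchor (I : DSec p → DSec p) (Θ : Cubic p) (e : DSec p) :
    (bigBracket I Θ).anchor e = Θ.anchor (I e) := rfl

end Cubic

lemma Bivector.endo_mk (π : Bivector p) (X : Sec E F V) (α : Sec E F' W) :
    π.endo ((X, α) : DSec p) = (π.sharp.map α, 0) := rfl

lemma TwoForm.endo_mk (ω : TwoForm p) (X : Sec E F V) (α : Sec E F' W) :
    ω.endo ((X, α) : DSec p) = (0, ω.flat.map X) := rfl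

lemma gamma_anchor (α : Sec E F' W) (x : M) :
    (gamma L ω π).anchor (0, α) x = L.anchor.toFun x (π.sharp.toFun x (α x)) := by
  simp only [gamma, schouten, Cubic.add_anchor, Cubic.smul_anchor, Cubic.bigBracket_anchor,
    Bivector.endo_mk, TwoForm.endo_mk, BundleMap.map_zero]
  simp [LieAlgebroid.toCubic]

/-- In `{ω, [π, π]}` only the term with `ω♭ Y` in the last slot survives. Expanding it, with `π♯ ω♭
Y = Y`, every term occurs twice: after the factor `½`, two of them cancel `μ_π` and what remains is
`-⟨ω♭ Y, [π♯ α, π♯ β]⟩`. -/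
lemma gamma_form (hinv : IsInverse ω π) (α β : Sec E F' W) (Y : Sec E F V) :
    (gamma L ω π).form (0, α) (0, β) (Y, 0) =
      p.apply (ω.flat.map (L.bracket (π.sharp.map α) (π.sharp.map β))) Y := by
  simp only [gamma, schouten, Cubic.add_form, Cubic.smul_form, Cubic.bigBracket_form,
    Bivector.endo_mk, TwoForm.endo_mk, BundleMap.map_zero, hinv.sharp_flat,
    L.toCubic_form_zero_left, L.toCubic_form_zero_middle, L.toCubic_form_zero_right]
  have h : (L.toCubic p).form (π.sharp.map α, 0) (π.sharp.map β, 0) (0, ω.flat.map Y) =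
      -p.apply (ω.flat.map (L.bracket (π.sharp.map α) (π.sharp.map β))) Y := by
    rw [← ω.apply_flat_comm]
    simp [LieAlgebroid.toCubic, LieAlgebroid.lieDerivative, LieAlgebroid.dOne]
  rw [h]
  module

lemma isStructureOf_transport [ContMDiffVectorBundle ∞ F V 𝓘(ℝ, E)] (hinv : IsInverse ω π)
    (c : ℝ) : IsStructureOf (L.transport hinv c) (c • gamma L ω π) := by
  refine ⟨fun α x => ?_, fun α β Y => ?_⟩
  · rw [Cubic.smul_anchor, Pi.smul_apply, gamma_anchor]
    exact (L.anchor.toFun x).map_smul c _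
  · rw [Cubic.smul_form, gamma_form L hinv, ← Pairing.apply_smul_left]
    rfl

variable {L} {K : LieAlgebroid E F' W} {c : ℝ}

lemma IsStructureOf.deriv_flat (hK : IsStructureOf K (c • gamma L ω π)) (hinv : IsInverse ω π)
    (X : Sec E F V) (f : M → ℝ) : K.deriv (ω.flat.map X) f = c • L.deriv X f := by
  rw [LieAlgebroid.deriv, LieAlgebroid.deriv, ← dirDeriv_smul_left]
  congr 1
  funext x
  rw [hK.1, Cubic.smul_anchor, Pi.smul_apply, gamma_anchor, BundleMap.map_apply, (hinv x).1]

lemma IsStructureOf.apply_bracket_flat (hK : IsStructureOf K (c • gamma L ω π))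
    (hinv : IsInverse ω π) (X Y Z : Sec E F V) :
    p.apply (K.bracket (ω.flat.map X) (ω.flat.map Y)) Z = c • ω.eval (L.bracket X Y) Z := by
  rw [hK.2, Cubic.smul_form, gamma_form L hinv, hinv.sharp_flat, hinv.sharp_flat, TwoForm.eval]

/-- If `ω♭ π'♯ ω♭ = s ω'♭`, the isomorphism `ω♭` takes the differential of `ω'` to that of `π'`,
up to a factor. -/
lemma IsStructureOf.d_flat (hK : IsStructureOf K (c • gamma L ω π)) (hinv : IsInverse ω π)
    {ω' : TwoForm p} {π' : Bivector p} {s : ℝ}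
    (h : ∀ X, ω.flat.map (π'.sharp.map (ω.flat.map X)) = s • ω'.flat.map X)
    (X Y Z : Sec E F V) :
    K.d π' (ω.flat.map X) (ω.flat.map Y) (ω.flat.map Z) = -(c * s) • L.d ω' X Y Z := by
  have he (X Y : Sec E F V) :
      TwoForm.eval π' (ω.flat.map X) (ω.flat.map Y) = (-s) • ω'.eval X Y := by
    change p.apply (ω.flat.map Y) (π'.sharp.map (ω.flat.map X)) = _
    -- The minus sign comes from the convention `π(α, β) = ⟨β, π♯ α⟩`, with `π♯ α` in the second
    -- slot.
    rw [ω.apply_flat_comm, h, Pairing.apply_smul_left, TwoForm.eval, neg_smul]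
  have hd (X Y Z : Sec E F V) :
      K.deriv (ω.flat.map X) (TwoForm.eval π' (ω.flat.map Y) (ω.flat.map Z)) =
        -(c * s) • L.deriv X (ω'.eval Y Z) := by
    rw [hK.deriv_flat hinv, he, L.deriv_smul_right _ _ (ω'.contMDiff_eval Y Z), smul_smul,
      mul_neg]
  have hb (X Y Z : Sec E F V) :
      TwoForm.eval π' (K.bracket (ω.flat.map X) (ω.flat.map Y)) (ω.flat.map Z) =
        -(c * s) • ω'.eval (L.bracket X Y) Z := by
    rw [TwoForm.eval, π'.apply_flat_comm, Pairing.flip_apply, hK.apply_bracket_flat hinv,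
      ← smul_neg, TwoForm.eval, ω.apply_flat_comm, h, Pairing.apply_smul_left, neg_neg,
      ω'.apply_flat_comm, TwoForm.eval]
    module
  rw [LieAlgebroid.d, LieAlgebroid.d, hd, hd, hd, hb, hb, hb]
  module

end Gamma

/-! ### Squares of the transition morphisms. -/

section Transition

variable {p : Pairing E F V F' W} {ω : ZMod 3 → TwoForm p} {π : ZMod 3 → Bivector p}
  {ε : ZMod 3 → ℝ}

/-- The transition morphisms of the bivectors are conjugate to the inverses of those of the
`2`-forms. -/
lemma transition_sq_of_sq (hinv : ∀ i, IsInverse (ω i) (π i)) {i : ZMod 3} (hε : ε i * ε i = 1)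
    (h : ∀ X, transition ω π i (transition ω π i X) = ε i • X) (α : Sec E F' W) :
    transition (p := p.flip) π ω i (transition (p := p.flip) π ω i α) = ε i • α := by
  -- The transition morphism on `W` is `ω (i-1)♭ ∘ N i⁻¹ ∘ π (i-1)♯`; the argument here is `N i⁻² (π
  -- (i-1)♯ α)`.
  have hX := h ((π (i + 1)).sharp.map ((ω (i - 1)).flat.map
    ((π (i + 1)).sharp.map α)))
  simp only [transition, (hinv _).sharp_flat, (hinv _).flat_sharp] at hX
  have h2 := congrArg (fun X => ε i • (ω (i - 1)).flat.map X) hX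
  simp only [BundleMap.map_smul, smul_smul, hε, one_smul, (hinv _).flat_sharp] at h2
  exact h2.symm

end Transition

lemma ZMod.eq_or_eq_add_three (i j : ZMod 3) : i = j ∨ i = j + 1 ∨ i = j - 1 := by
  revert i j
  decide

lemma ZMod.add_one_add_one_three (j : ZMod 3) : j + 1 + 1 = j - 1 := by
  revert j
  decide

lemma ZMod.sub_one_sub_one_three (j : ZMod 3) : j - 1 - 1 = j + 1 := by
  revert j
  decide

/-! ### Comparison of the torsion conditions under `ω j♭`. -/

section Torsion

variable {p : Pairing E F V F' W} {ω : ZMod 3 → TwoForm p} {π : ZMod 3 → Bivector p}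
  {ε : ZMod 3 → ℝ}

/-- In `ℤ/3`, `N (j-1) = π (j+1)♯ ω j♭`; apply `ω (j+1)♭` to its square. -/
lemma flat_sharp_flat_add_one (hinv : ∀ i, IsInverse (ω i) (π i)) {j : ZMod 3}
    (h : ∀ X, transition ω π (j - 1) (transition ω π (j - 1) X) = ε (j - 1) • X)
    (X : Sec E F V) :
    (ω j).flat.map ((π (j + 1)).sharp.map ((ω j).flat.map X)) =
      ε (j - 1) • (ω (j + 1)).flat.map X := by
  have e := ZMod.sub_one_sub_one_three j
  have hX := congrArg (ω (j + 1)).flat.map (h X)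
  simpa only [transition, e, sub_add_cancel, (hinv _).flat_sharp, BundleMap.map_smul] using hX

lemma flat_sharp_flat_sub_one (hinv : ∀ i, IsInverse (ω i) (π i)) {j : ZMod 3}
    (hε : ε (j + 1) * ε (j + 1) = 1)
    (h : ∀ X, transition ω π (j + 1) (transition ω π (j + 1) X) = ε (j + 1) • X)
    (X : Sec E F V) :
    (ω j).flat.map ((π (j - 1)).sharp.map ((ω j).flat.map X)) =
      ε (j + 1) • (ω (j - 1)).flat.map X := by
  have e := ZMod.add_one_add_one_three j
  -- Here `N (j+1) = π j♯ ω (j-1)♭`, and its square is evaluated at `N (j+1)⁻¹ X`.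
  have hX := congrArg (fun Y => ε (j + 1) • (ω j).flat.map Y)
    (h ((π (j - 1)).sharp.map ((ω j).flat.map X)))
  simp only [transition, e, add_sub_cancel_right, (hinv _).flat_sharp, (hinv _).sharp_flat,
    BundleMap.map_smul, smul_smul, hε, one_smul] at hX
  exact hX.symm

variable [IsManifold 𝓘(ℝ, E) ∞ M] {L : LieAlgebroid E F V} {K : LieAlgebroid E F' W}

/-- Inverses are unique, so the existential can be replaced by the given bivectors. -/
lemma isEpsHST_iff (hinv : ∀ i, IsInverse (ω i) (π i)) :
    IsEpsHST L ε ω ↔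
      (∀ i X, transition ω π i (transition ω π i X) = ε i • X) ∧
      (∀ i j X Y Z,
        ε (i + 1) •
            L.d (ω i) (transition ω π i X) (transition ω π i Y) (transition ω π i Z) =
          ε (j + 1) •
            L.d (ω j) (transition ω π j X) (transition ω π j Y) (transition ω π j Z)) := by
  refine ⟨fun ⟨π', hπ', h⟩ => ?_, fun h => ⟨π, hinv, h⟩⟩
  have ht : ∀ i X, transition ω π' i X = transition ω π i X :=
    fun i X => (hinv _).sharp_map_eq (hπ' _) _
  simpa only [ht] using h

/-- The isomorphism `ω j♭` takes the transition morphisms of the `2`-forms to those of the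
bivectors, up to signs. -/
lemma transition_flat (hinv : ∀ i, IsInverse (ω i) (π i)) (hε : ∀ i, ε i * ε i = 1)
    (hprod : ∀ i, ε i * ε (i + 1) * ε (i - 1) = -1)
    (h : ∀ i X, transition ω π i (transition ω π i X) = ε i • X) (i j : ZMod 3)
    (X : Sec E F V) :
    transition (p := p.flip) π ω i ((ω j).flat.map X) =
      (ω j).flat.map ((if i = j then -ε i else ε i) • transition ω π i X) := by
  have hadd := fun j => flat_sharp_flat_add_one hinv (j := j) (h (j - 1))
  have hsub := fun j => flat_sharp_flat_sub_one hinv (j := j) (hε _) (h (j + 1))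
  change (ω (i - 1)).flat.map ((π (i + 1)).sharp.map ((ω j).flat.map X)) =
    (ω j).flat.map (_ • (π (i - 1)).sharp.map ((ω (i + 1)).flat.map X))
  rcases ZMod.eq_or_eq_add_three i j with rfl | rfl | rfl
  -- Both sides are multiples of `ω (i-1)♭ π i♯ ω (i+1)♭ X`, with factors `ε (i-1)` and `-ε i * ε
  -- (i+1)`. This is the only case that needs the product of the signs.
  · have h1 := hsub i ((π i).sharp.map ((ω (i + 1)).flat.map X))
    have h2 := congrArg (π i).sharp.map (hadd i X)
    rw [(hinv _).flat_sharp] at h1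
    rw [(hinv _).sharp_flat, BundleMap.map_smul] at h2
    rw [if_pos rfl, BundleMap.map_smul, h1, h2, BundleMap.map_smul, smul_smul]
    congr 1
    linear_combination ε (i - 1) * hprod i - ε i * ε (i + 1) * hε (i - 1)
  · have e : j + 1 + 1 = j - 1 := by revert j; decide
    rw [if_neg (by simp), add_sub_cancel_right, e, hsub, BundleMap.map_smul,
      (hinv _).flat_sharp]
  · have e : j - 1 - 1 = j + 1 := by revert j; decide
    rw [if_neg (by simp), sub_add_cancel, e, (hinv _).sharp_flat,
      BundleMap.map_smul, hadd, smul_smul, hε, one_smul]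

/-- Two signs multiply to `1`: the factor `-(ε j * s)` of `d_flat`, and the cube of the factor `±ε
i` of `transition_flat`. -/
lemma IsStructureOf.d_transition_flat (hinv : ∀ i, IsInverse (ω i) (π i))
    (hε : ∀ i, ε i * ε i = 1) (hprod : ∀ i, ε i * ε (i + 1) * ε (i - 1) = -1)
    (h : ∀ i X, transition ω π i (transition ω π i X) = ε i • X) {j : ZMod 3}
    (hK : IsStructureOf K (ε j • gamma L (ω j) (π j))) (i : ZMod 3) (X Y Z : Sec E F V) :
    K.d (p := p.flip) (π i)
        (transition (p := p.flip) π ω i ((ω j).flat.map X))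
        (transition (p := p.flip) π ω i ((ω j).flat.map Y))
        (transition (p := p.flip) π ω i ((ω j).flat.map Z)) =
      L.d (ω i) (transition ω π i X) (transition ω π i Y) (transition ω π i Z) := by
  simp only [transition_flat hinv hε hprod h]
  rcases ZMod.eq_or_eq_add_three i j with rfl | rfl | rfl
  -- The total factor is `-ε i * (-ε i) ^ 3 = 1`.
  · rw [hK.d_flat (hinv _) (ω' := ω i) (s := 1)
        (fun X => by rw [(hinv _).sharp_flat, one_smul]), L.d_smul, smul_smul, if_pos rfl]
    convert one_smul ℝ _ using 2
    linear_combination (ε i * ε i + 1) * hε i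
  -- The total factor is `-(ε j * ε (j-1)) * ε (j+1) ^ 3`, which is `1` by the product condition;
  -- the last case is symmetric.
  · rw [hK.d_flat (hinv _) (ω' := ω (j + 1)) (flat_sharp_flat_add_one hinv (h _)), L.d_smul,
      smul_smul, if_neg (by simp)]
    convert one_smul ℝ _ using 2
    linear_combination (-ε (j + 1) ^ 2) * hprod j + hε (j + 1)
  · rw [hK.d_flat (hinv _) (ω' := ω (j - 1)) (flat_sharp_flat_sub_one hinv (hε _) (h _)),
      L.d_smul, smul_smul, if_neg (by simp)]
    convert one_smul ℝ _ using 2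
    linear_combination (-ε (j - 1) ^ 2) * hprod j + hε (j - 1)

lemma isEpsHST_iff_of_isStructureOf (hinv : ∀ i, IsInverse (ω i) (π i))
    (hε : ∀ i, ε i * ε i = 1) (hprod : ∀ i, ε i * ε (i + 1) * ε (i - 1) = -1) {j : ZMod 3}
    (hK : IsStructureOf K (ε j • gamma L (ω j) (π j))) :
    IsEpsHST L ε ω ↔ IsEpsHST (p := p.flip) K ε π := by
  have hinv' : ∀ i, IsInverse (p := p.flip) (π i) (ω i) := fun i => (hinv i).symm
  rw [isEpsHST_iff hinv, isEpsHST_iff hinv']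
  constructor
  · rintro ⟨h, hd⟩
    refine ⟨fun i => transition_sq_of_sq hinv (hε i) (h i), fun i i' α β γ => ?_⟩
    -- Every section of `W` lies in the image of `ω j♭`.
    rw [← (hinv j).flat_sharp α, ← (hinv j).flat_sharp β, ← (hinv j).flat_sharp γ]
    simp only [hK.d_transition_flat hinv hε hprod h]
    exact hd i i' _ _ _
  · rintro ⟨h', hd⟩
    have h : ∀ i X, transition ω π i (transition ω π i X) = ε i • X :=
      -- The roles of `V` and `W` are exchanged: the double flip of the pairing is the pairing
      -- itself.
      fun i => transition_sq_of_sq hinv' (hε i) (h' i)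
    refine ⟨h, fun i i' X Y Z => ?_⟩
    have := hd i i' ((ω j).flat.map X) ((ω j).flat.map Y) ((ω j).flat.map Z)
    simpa only [hK.d_transition_flat hinv hε hprod h] using this

end Torsion

lemma mul_mul_cyclic_eq {ε : ZMod 3 → ℝ} (h : ε 1 * ε 2 * ε 3 = -1) (i : ZMod 3) :
    ε i * ε (i + 1) * ε (i - 1) = -1 := by
  have e : (i = 0 ∧ i + 1 = 1 ∧ i - 1 = 2) ∨ (i = 1 ∧ i + 1 = 2 ∧ i - 1 = 3) ∨
      (i = 2 ∧ i + 1 = 3 ∧ i - 1 = 1) := by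
    revert i
    decide
  have h0 : (0 : ZMod 3) = 3 := by decide
  rcases e with ⟨e₁, e₂, e₃⟩ | ⟨e₁, e₂, e₃⟩ | ⟨e₁, e₂, e₃⟩ <;> rw [e₂, e₃, e₁]
  · rw [h0]
    linarith
  · exact h
  · linarith

end Bundles

end HSTorsion

open HSTorsion in
theorem mainTheorem5
    {E : Type*} [NormedAddCommGroup E] [NormedSpace ℝ E] [FiniteDimensional ℝ E]
    {M : Type*} [TopologicalSpace M] [T2Space M] [SigmaCompactSpace M]
    [ChartedSpace E M] [IsManifold 𝓘(ℝ, E) ∞ M]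
    {F : Type*} [NormedAddCommGroup F] [NormedSpace ℝ F] [FiniteDimensional ℝ F]
    {V : M → Type*} [TopologicalSpace (TotalSpace F V)]
    [∀ x, AddCommGroup (V x)] [∀ x, Module ℝ (V x)] [∀ x, TopologicalSpace (V x)]
    [FiberBundle F V] [VectorBundle ℝ F V] [ContMDiffVectorBundle ∞ F V 𝓘(ℝ, E)]
    (L : LieAlgebroid E F V)
    (ω : ZMod 3 → TwoForm (dualPairing E F V))
    (π : ZMod 3 → Bivector (dualPairing E F V))
    (hinv : ∀ i, IsInverse (ω i) (π i))
    (ε : ZMod 3 → ℝ) (hε : ∀ i, ε i = 1 ∨ ε i = -1) (i : ZMod 3) :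
    (∃ K : LieAlgebroid E (F →L[ℝ] ℝ) (DualBundle V),
      IsStructureOf K (ε i • gamma L (ω i) (π i))) ∧
    ∀ K : LieAlgebroid E (F →L[ℝ] ℝ) (DualBundle V),
      IsStructureOf K (ε i • gamma L (ω i) (π i)) →
      (IsHypersymplecticWithTorsion L ε ω ↔ IsHypersymplecticWithTorsion K ε π) ∧
      (IsParaHypersymplecticWithTorsion L ε ω ↔ IsParaHypersymplecticWithTorsion K ε π) := by
  have hsq : ∀ i, ε i * ε i = 1 := fun i => by rcases hε i with h | h <;> simp [h]
  refine ⟨⟨L.transport (hinv i) (ε i), isStructureOf_transport L (hinv i) (ε i)⟩,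
    fun K hK => ⟨?_, ?_⟩⟩
  · refine and_congr_right fun h => ?_
    exact isEpsHST_iff_of_isStructureOf hinv hsq (mul_mul_cyclic_eq (by norm_num [h])) hK
  · refine and_congr_right fun h => and_congr_right fun _ => ?_
    exact isEpsHST_iff_of_isStructureOf hinv hsq (mul_mul_cyclic_eq h) hK
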